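/- Let $\mathcal H=\ell^2(\mathbb Z;\mathbb C^2)$ and write $\Psi(x)={}^T[\Psi_L(x)\ \ \Psi_R(x)]$ for $\Psi\in\mathcal H$. For $j\in\{m,o,p\}$ let $\alpha_j,\beta_j\in\mathbb C$ and $\Delta_j\in\mathbb R$ with $\alpha_j\neq0$ and $|\alpha_j|^2+|\beta_j|^2=1$. Put $(\alpha_x,\beta_x,\Delta_x)=(\alpha_m,\beta_m,\Delta_m)$ for $x<0$, $(\alpha_o,\beta_o,\Delta_o)$ for $x=0$, and $(\alpha_p,\beta_p,\Delta_p)$ for $x>0$. The two-phase quantum walk with one defect is the operator $U=S\tilde C$ on $\mathcal H$, where $$(S\Psi)(x)=\begin{bmatrix}\Psi_L(x+1)\\ \Psi_R(x-1)\end{bmatrix},\qquad (\tilde C\Psi)(x)=e^{i\Delta_x}\begin{bmatrix}\alpha_x&\beta_x\\-\overline{\beta_x}&\overline{\alpha_x}\end{bmatrix}\Psi(x).$$ Let $\sigma_{\rm p}(U)$ denote the set of eigenvalues of $U$. Assume $\beta_o=0$, $|\beta_p|=|\beta_m|=|\beta|$ with $|\beta|>0$, and $\Delta_p=\Delta_m=\Delta$.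 Let $C=\Delta_o+(\arg\beta_p-\arg\beta_m)/2$, where $\arg\beta_p,\arg\beta_m\in\mathbb R$ are any choices of arguments of $\beta_p,\beta_m$. Put $$e^{i\lambda_1}=\frac{e^{i\Delta}-i|\beta|e^{iC}}{\left|e^{i\Delta}-i|\beta|e^{iC}\right|},\quad e^{i\lambda_2}=-e^{i\lambda_1},\qquad e^{i\lambda_3}=\frac{e^{i\Delta}+i|\beta|e^{iC}}{\left|e^{i\Delta}+i|\beta|e^{iC}\right|},\quad e^{i\lambda_4}=-e^{i\lambda_3},$$ and consider - Condition 1: $\sin(\Delta-C)\in[-1,|\beta|)$; - Condition 2: $\sin(\Delta-C)\in(-|\beta|,1]$. Then $\sigma_{\rm p}(U)\neq\emptyset$. If Condition 1 holds, then $e^{i\lambda_1},e^{i\lambda_2}\in\sigma_{\rm p}(U)$; if Condition 2 holds, then $e^{i\lambda_3},e^{i\lambda_4}\in\sigma_{\rm p}(U)$. These are all the eigenvalues: every element of $\sigma_{\rm p}(U)$ is $e^{i\lambda_1}$ or $e^{i\lambda_2}$ with Condition 1 holding, or $e^{i\lambda_3}$ or $e^{i\lambda_4}$ with Condition 2 holding.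 In particular, if both conditions hold, then $\sigma_{\rm p}(U)=\{e^{i\lambda_1},e^{i\lambda_2},e^{i\lambda_3},e^{i\lambda_4}\}$ has exactly four elements. -/

import Mathlib

/-- The Hilbert space `ℓ²(ℤ; ℂ²)`. For `Ψ` in it, `Ψ x 0` is the left component and `Ψ x 1` the
right component of the state at the site `x`. -/
abbrev QWSpace : Type := lp (fun _ : ℤ => EuclideanSpace ℂ (Fin 2)) 2

/-- The parameters `(α, β, Δ)` of a coin matrix, with `α ≠ 0` and `|α|² + |β|² = 1`. -/
structure CoinParam where
  α : ℂ
  β : ℂ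
  Δ : ℝ
  normalized : ‖α‖ ^ 2 + ‖β‖ ^ 2 = 1
  α_ne_zero : α ≠ 0

namespace CoinParam

/-- The coin matrix `e^{iΔ} [[α, β], [-conj β, conj α]]`. -/
noncomputable def coinMatrix (c : CoinParam) : Matrix (Fin 2) (Fin 2) ℂ :=
  Complex.exp (Complex.I * (c.Δ : ℂ)) •
    !![c.α, c.β; -(starRingEnd ℂ) c.β, (starRingEnd ℂ) c.α]

theorem norm_coinMatrix_apply (c : CoinParam) (v : EuclideanSpace ℂ (Fin 2)) :
    ‖Matrix.toEuclideanLin c.coinMatrix v‖ = ‖v‖ := by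
  have hexp : ‖Complex.exp (Complex.I * (c.Δ : ℂ))‖ = 1 := by
    rw [mul_comm]; exact Complex.norm_exp_ofReal_mul_I c.Δ
  have h := c.normalized
  rw [coinMatrix, map_smul, LinearMap.smul_apply, norm_smul, hexp, one_mul,
    EuclideanSpace.norm_eq, EuclideanSpace.norm_eq]
  congr 1
  simp only [Fin.sum_univ_two, ← Complex.normSq_eq_norm_sq] at h ⊢
  simp only [Matrix.toLpLin_apply, Matrix.mulVec, dotProduct, Fin.sum_univ_two,
    Matrix.of_apply, Matrix.cons_val_zero, Matrix.cons_val_one, Matrix.cons_val']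
  simp only [Complex.normSq_apply, Complex.add_re, Complex.add_im, Complex.mul_re, Complex.mul_im,
    Complex.neg_re, Complex.neg_im, Complex.conj_re, Complex.conj_im] at h ⊢
  linear_combination ((v 0).re ^ 2 + (v 0).im ^ 2 + (v 1).re ^ 2 + (v 1).im ^ 2) * h

end CoinParam

theorem QWSpace.summable_component (Ψ : QWSpace) (j : Fin 2) :
    Summable fun x : ℤ => ‖Ψ x j‖ ^ 2 := by
  have h : Summable fun x : ℤ => ‖Ψ x‖ ^ 2 := by
    have h0 := (memℓp_gen_iff (by norm_num)).1 (lp.memℓp Ψ)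
    simpa using h0
  exact h.of_nonneg_of_le (fun x => by positivity) fun x => by
    have := PiLp.norm_apply_le (Ψ x) j
    gcongr

theorem shift_memℓp (Ψ : QWSpace) :
    Memℓp (E := fun _ : ℤ => EuclideanSpace ℂ (Fin 2))
      (fun x : ℤ => !₂[Ψ (x + 1) 0, Ψ (x - 1) 1]) 2 := by
  refine (memℓp_gen_iff (by norm_num)).2 ?_
  have h0 : Summable fun x : ℤ => ‖Ψ (x + 1) 0‖ ^ 2 :=
    (Equiv.addRight (1 : ℤ)).summable_iff (f := fun x : ℤ => ‖Ψ x 0‖ ^ 2) |>.2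
      (QWSpace.summable_component Ψ 0)
  have h1 : Summable fun x : ℤ => ‖Ψ (x - 1) 1‖ ^ 2 :=
    (Equiv.subRight (1 : ℤ)).summable_iff (f := fun x : ℤ => ‖Ψ x 1‖ ^ 2) |>.2
      (QWSpace.summable_component Ψ 1)
  refine (h0.add h1).congr fun x => ?_
  rw [ENNReal.toReal_ofNat, Real.rpow_ofNat, EuclideanSpace.norm_sq_eq, Fin.sum_univ_two]
  rfl

theorem coin_memℓp (c : ℤ → CoinParam) (Ψ : QWSpace) :
    Memℓp (fun x : ℤ => Matrix.toEuclideanLin (c x).coinMatrix (Ψ x)) 2 := by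
  refine (memℓp_gen_iff (by norm_num)).2 ?_
  simpa only [CoinParam.norm_coinMatrix_apply] using
    (memℓp_gen_iff (by norm_num)).1 (lp.memℓp Ψ)

/-- The shift operator `(S Ψ)(x) = (Ψ_L(x + 1), Ψ_R(x - 1))`. -/
noncomputable def shiftOp : QWSpace →ₗ[ℂ] QWSpace where
  toFun Ψ := ⟨fun x : ℤ => !₂[Ψ (x + 1) 0, Ψ (x - 1) 1], shift_memℓp Ψ⟩
  map_add' Ψ Φ := by
    ext x j
    fin_cases j <;> rfl
  map_smul' a Ψ := by
    ext x j
    fin_cases j <;> rfl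

/-- The coin operator `(C Ψ)(x) = C_x Ψ(x)`, with `C_x` the coin matrix at the site `x`. -/
noncomputable def coinOp (c : ℤ → CoinParam) : QWSpace →ₗ[ℂ] QWSpace where
  toFun Ψ := ⟨fun x : ℤ => Matrix.toEuclideanLin (c x).coinMatrix (Ψ x), coin_memℓp c Ψ⟩
  map_add' Ψ Φ := by
    ext x : 2
    exact map_add (Matrix.toEuclideanLin (c x).coinMatrix) (Ψ x) (Φ x)
  map_smul' a Ψ := by
    ext x : 2
    exact map_smul (Matrix.toEuclideanLin (c x).coinMatrix) a (Ψ x)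

/-- The time evolution `U = S C` of the quantum walk with coins `c`. -/
noncomputable def timeEvolution (c : ℤ → CoinParam) : QWSpace →ₗ[ℂ] QWSpace :=
  shiftOp ∘ₗ coinOp c

/-- The set of eigenvalues `σ_p(T)`. -/
def pointSpectrum (T : QWSpace →ₗ[ℂ] QWSpace) : Set ℂ :=
  {z | Module.End.HasEigenvalue T z}

/-- The coins of the two-phase quantum walk with one defect: `m` on the negative sites, `o` at the
origin, `p` on the positive sites. -/
def twoPhaseOneDefect (m o p : CoinParam) (x : ℤ) : CoinParam :=
  if x < 0 then m else if x = 0 then o else p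

/-! The pairs (Ψ_L(x-1), Ψ_R(x)) turn UΨ = zΨ into a first-order recursion. With ω = z e^{-iΔ_x},
its matrix is α⁻¹ [[ω, -β], [-conj β, conj ω]], and |z| = 1 because U is isometric. Away from the
origin the coin is constant on each side, so an ℓ² solution must lie on a contracting eigenline
there. The eigenvalues are κ/α with κ² - 2 Re(ω) κ + |α|² = 0. The two roots have product |α|², so
contraction means |κ| < |α|, which forces κ to be real and determines it. Reversing direction
replaces (α, β, ω) by (conj α, -β, conj ω); since |α_p| = |α_m|, both sides share the same κ.

The defect is diagonal because β_o = 0. Matching the two eigenlines across it gives (ω - κ) z² = -F²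
(conj ω - κ) with F = e^{iC}. Since (ω - κ)(conj ω - κ) = |β|², this becomes the quantization
condition (ω - κ) z = i s F with s = ±|β|. Eliminating κ between this and its conjugate leaves z²
conj w = w for w = e^{iΔ} + i s F, hence z = ±w/|w| and |κ| = (1 - s²)/|w|. As |w|² = 1 + s² + 2s
sin(Δ - C), the decay requirement κ² < 1 - s² reads -s² < s sin(Δ - C): Condition 2 for s = |β|,
Condition 1 for s = -|β|.

The two directions are `quantization_of_hasEigenvalue` and `hasEigenvalue_of_quantization`; the
algebra of the condition is in `eq_of_quantization` and `quantization_of_eq`. -/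

open Filter Topology ComplexConjugate

/-! ### Decaying solutions of the transfer recursion -/

/-- The norms ‖u n‖ are nondecreasing and tend to zero. -/
theorem eq_zero_of_expanding_recursion {α κ : ℂ} (hα : α ≠ 0) (h : ‖α‖ ≤ ‖κ‖) {u : ℕ → ℂ}
    (hu : ∀ n, α * u (n + 1) = κ * u n) (h0 : Tendsto u atTop (𝓝 0)) (n : ℕ) : u n = 0 := by
  have hmono : Monotone fun n => ‖u n‖ := by
    refine monotone_nat_of_le_succ fun n => ?_
    have h1 : ‖α‖ * ‖u (n + 1)‖ = ‖κ‖ * ‖u n‖ := by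
      rw [← norm_mul, ← norm_mul, hu]
    have h2 : 0 < ‖α‖ := norm_pos_iff.2 hα
    have h3 := mul_le_mul_of_nonneg_right h (norm_nonneg (u n))
    exact le_of_mul_le_mul_left (h3.trans h1.ge) h2
  have := hmono.ge_of_tendsto (by simpa using h0.norm) n
  simpa using this

theorem exists_sum_prod_eq (s p : ℂ) : ∃ κ₁ κ₂ : ℂ, κ₁ + κ₂ = s ∧ κ₁ * κ₂ = p ∧ ‖κ₂‖ ≤ ‖κ₁‖ := by
  obtain ⟨d, hd⟩ := IsAlgClosed.exists_eq_mul_self (s ^ 2 / 4 - p)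
  rcases le_total ‖s / 2 - d‖ ‖s / 2 + d‖ with h | h
  · exact ⟨s / 2 + d, s / 2 - d, by ring, by linear_combination hd, h⟩
  · exact ⟨s / 2 - d, s / 2 + d, by ring, by linear_combination hd, h⟩

/-- A nonreal root of a real quadratic is paired with its conjugate, so its squared modulus would
equal the constant term p. -/
theorem exists_real_of_quadratic {κ : ℂ} {c p : ℝ} (h : κ ^ 2 - 2 * c * κ + p = 0)
    (hκ : ‖κ‖ ^ 2 < p) : ((κ.re : ℝ) : ℂ) = κ := by
  have hre := congrArg Complex.re h
  have him := congrArg Complex.im h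
  simp only [pow_two, Complex.add_re, Complex.sub_re, Complex.mul_re, Complex.mul_im,
    Complex.ofReal_re, Complex.ofReal_im, Complex.re_ofNat, Complex.im_ofNat, Complex.zero_re,
    Complex.zero_im, Complex.add_im, Complex.sub_im] at hre him
  rw [← Complex.normSq_eq_norm_sq, Complex.normSq_apply] at hκ
  have h0 : κ.im * (κ.re - c) = 0 := by linarith
  rcases mul_eq_zero.1 h0 with h1 | h1
  · exact Complex.ext (by simp) (by simp [h1])
  · exfalso
    have : c = κ.re := by linarith
    subst this
    nlinarith

/-- A solution of the recursion that tends to zero starts in the contracting eigenspace. -/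
theorem exists_contracting_eigenvalue {α β ω : ℂ} (hα : α ≠ 0) (hβ : β ≠ 0)
    (hn : ‖α‖ ^ 2 + ‖β‖ ^ 2 = 1) (hω : ‖ω‖ = 1) {a b : ℕ → ℂ}
    (ha : ∀ n, α * a (n + 1) = ω * a n - β * b n)
    (hb : ∀ n, α * b (n + 1) = -conj β * a n + conj ω * b n)
    (ha0 : Tendsto a atTop (𝓝 0)) (hb0 : Tendsto b atTop (𝓝 0)) (hne : a 0 ≠ 0 ∨ b 0 ≠ 0) :
    a 0 ≠ 0 ∧ ∃ κ : ℝ, κ ^ 2 < ‖α‖ ^ 2 ∧ κ ^ 2 - 2 * ω.re * κ + ‖α‖ ^ 2 = 0 ∧ (ω - κ) * a 0 = β * b 0 := by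
  obtain ⟨κ₁, κ₂, hs, hp, hle⟩ := exists_sum_prod_eq (ω + conj ω) ((‖α‖ ^ 2 : ℝ) : ℂ)
  have hωc : ω * conj ω = 1 := by rw [Complex.mul_conj']; simp [hω]
  have hβc : β * conj β = 1 - ((‖α‖ ^ 2 : ℝ) : ℂ) := by
    rw [Complex.mul_conj', eq_sub_iff_add_eq']; exact_mod_cast hn
  have hle' : ‖α‖ ≤ ‖κ₁‖ := by
    have h1 : ‖κ₁‖ * ‖κ₂‖ = ‖α‖ ^ 2 := by
      rw [← norm_mul, hp, Complex.norm_real, Real.norm_of_nonneg (by positivity)]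
    refine le_of_sq_le_sq ?_ (norm_nonneg _)
    rw [← h1, pow_two]
    gcongr
  -- The row (ω - κ₂, -β) is a left eigenvector for κ₁, the root of larger modulus, so this
  -- combination obeys an expanding recursion.
  have hu : ∀ n, (ω - κ₂) * a n - β * b n = 0 := by
    refine eq_zero_of_expanding_recursion (u := fun n => (ω - κ₂) * a n - β * b n) hα hle'
      (fun n => ?_) ?_
    · linear_combination (ω - κ₂) * ha n - β * hb n + a n * hβc + a n * hp
        - (ω * a n - β * b n) * hs - a n * hωc
    · simpa using (ha0.const_mul (ω - κ₂)).sub (hb0.const_mul β)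
  have hne' : a 0 ≠ 0 := by
    intro h
    have := hu 0
    rw [h] at this
    simp_all
  -- By `hu` the sequence `a` itself satisfies α a(n+1) = κ₂ a(n), which would be expanding as well.
  have hlt : ‖κ₂‖ < ‖α‖ := by
    by_contra! hge
    exact hne' (eq_zero_of_expanding_recursion hα hge
      (fun n => by linear_combination ha n + hu n) ha0 0)
  have hq : κ₂ ^ 2 - 2 * (ω.re : ℂ) * κ₂ + ((‖α‖ ^ 2 : ℝ) : ℂ) = 0 := by
    have : ω + conj ω = 2 * (ω.re : ℂ) := by rw [Complex.add_conj]; push_cast; ring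
    linear_combination -hp + κ₂ * hs + κ₂ * this
  have hsq : ‖κ₂‖ ^ 2 < ‖α‖ ^ 2 := by gcongr
  have hre := exists_real_of_quadratic hq hsq
  refine ⟨hne', κ₂.re, ?_, ?_, ?_⟩
  · rw [← hre, Complex.norm_real, Real.norm_eq_abs, sq_abs] at hsq
    exact hsq
  · rw [← hre] at hq
    exact_mod_cast hq
  · rw [hre]
    linear_combination hu 0

/-! ### The eigenvalue equation and its transfer form -/

theorem timeEvolution_eq_smul_iff (c : ℤ → CoinParam) (Ψ : QWSpace) (z : ℂ) :
    timeEvolution c Ψ = z • Ψ ↔ ∀ x : ℤ,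
      z * Ψ (x - 1) 0 = Complex.exp (Complex.I * ((c x).Δ : ℂ)) *
        ((c x).α * Ψ x 0 + (c x).β * Ψ x 1) ∧
      z * Ψ (x + 1) 1 = Complex.exp (Complex.I * ((c x).Δ : ℂ)) *
        (-conj (c x).β * Ψ x 0 + conj (c x).α * Ψ x 1) := by
  have hcoin0 (x : ℤ) : coinOp c Ψ x 0 = Complex.exp (Complex.I * ((c x).Δ : ℂ)) *
      ((c x).α * Ψ x 0 + (c x).β * Ψ x 1) := by
    simp only [coinOp, CoinParam.coinMatrix, LinearMap.coe_mk, AddHom.coe_mk, map_smul,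
      LinearMap.smul_apply, PiLp.smul_apply, smul_eq_mul]
    simp [Matrix.toLpLin_apply, dotProduct, Fin.sum_univ_two]
  have hcoin1 (x : ℤ) : coinOp c Ψ x 1 = Complex.exp (Complex.I * ((c x).Δ : ℂ)) *
      (-conj (c x).β * Ψ x 0 + conj (c x).α * Ψ x 1) := by
    simp only [coinOp, CoinParam.coinMatrix, LinearMap.coe_mk, AddHom.coe_mk, map_smul,
      LinearMap.smul_apply, PiLp.smul_apply, smul_eq_mul]
    simp [Matrix.toLpLin_apply, dotProduct, Fin.sum_univ_two]
  have hU0 (x : ℤ) : timeEvolution c Ψ x 0 = coinOp c Ψ (x + 1) 0 := rfl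
  have hU1 (x : ℤ) : timeEvolution c Ψ x 1 = coinOp c Ψ (x - 1) 1 := rfl
  have hz (x : ℤ) (j : Fin 2) : (z • Ψ) x j = z * Ψ x j := rfl
  constructor
  · intro h x
    rw [← hcoin0, ← hcoin1]
    constructor
    · rw [← hz, ← h, hU0, sub_add_cancel]
    · rw [← hz, ← h, hU1, add_sub_cancel_right]
  · intro h
    ext x j
    fin_cases j
    · have := (h (x + 1)).1
      rw [add_sub_cancel_right, ← hcoin0] at this
      exact this.symm
    · have := (h (x - 1)).2
      rw [sub_add_cancel, ← hcoin1] at this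
      exact this.symm

theorem QWSpace.norm_sq_eq_tsum (Ψ : QWSpace) : ‖Ψ‖ ^ 2 = ∑' x : ℤ, ‖Ψ x‖ ^ 2 := by
  have := lp.norm_rpow_eq_tsum (p := 2) (by norm_num) Ψ
  simpa using this

theorem norm_shiftOp (Ψ : QWSpace) : ‖shiftOp Ψ‖ = ‖Ψ‖ := by
  have h0 : Summable fun x : ℤ => ‖Ψ (x + 1) 0‖ ^ 2 :=
    (Equiv.addRight (1 : ℤ)).summable_iff (f := fun x : ℤ => ‖Ψ x 0‖ ^ 2) |>.2
      (QWSpace.summable_component Ψ 0)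
  have h1 : Summable fun x : ℤ => ‖Ψ (x - 1) 1‖ ^ 2 :=
    (Equiv.subRight (1 : ℤ)).summable_iff (f := fun x : ℤ => ‖Ψ x 1‖ ^ 2) |>.2
      (QWSpace.summable_component Ψ 1)
  have hS (x : ℤ) : ‖shiftOp Ψ x‖ ^ 2 = ‖Ψ (x + 1) 0‖ ^ 2 + ‖Ψ (x - 1) 1‖ ^ 2 := by
    rw [EuclideanSpace.norm_sq_eq, Fin.sum_univ_two]; rfl
  have hΨ (x : ℤ) : ‖Ψ x‖ ^ 2 = ‖Ψ x 0‖ ^ 2 + ‖Ψ x 1‖ ^ 2 := by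
    rw [EuclideanSpace.norm_sq_eq, Fin.sum_univ_two]
  have e0 := (Equiv.addRight (1 : ℤ)).tsum_eq fun x : ℤ => ‖Ψ x 0‖ ^ 2
  have e1 := (Equiv.subRight (1 : ℤ)).tsum_eq fun x : ℤ => ‖Ψ x 1‖ ^ 2
  simp only [Equiv.coe_addRight, Equiv.subRight_apply] at e0 e1
  have : ‖shiftOp Ψ‖ ^ 2 = ‖Ψ‖ ^ 2 := by
    rw [QWSpace.norm_sq_eq_tsum, QWSpace.norm_sq_eq_tsum]
    simp only [hS, hΨ]
    rw [h0.tsum_add h1, e0, e1,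
      (QWSpace.summable_component Ψ 0).tsum_add (QWSpace.summable_component Ψ 1)]
  exact (sq_eq_sq₀ (norm_nonneg _) (norm_nonneg _)).1 this

theorem norm_coinOp (c : ℤ → CoinParam) (Ψ : QWSpace) : ‖coinOp c Ψ‖ = ‖Ψ‖ := by
  have : ‖coinOp c Ψ‖ ^ 2 = ‖Ψ‖ ^ 2 := by
    rw [QWSpace.norm_sq_eq_tsum, QWSpace.norm_sq_eq_tsum]
    exact tsum_congr fun x => by
      rw [← CoinParam.norm_coinMatrix_apply (c x) (Ψ x)]; rfl
  exact (sq_eq_sq₀ (norm_nonneg _) (norm_nonneg _)).1 this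

theorem norm_eq_one_of_timeEvolution_eq_smul {c : ℤ → CoinParam} {Ψ : QWSpace} {z : ℂ}
    (h : timeEvolution c Ψ = z • Ψ) (hΨ : Ψ ≠ 0) : ‖z‖ = 1 := by
  have h1 : ‖timeEvolution c Ψ‖ = ‖Ψ‖ := by
    rw [timeEvolution, LinearMap.comp_apply, norm_shiftOp, norm_coinOp]
  rw [h, norm_smul] at h1
  exact mul_eq_right₀ (norm_ne_zero_iff.2 hΨ) |>.1 h1

/-- The eigenvalue equations at one site give the incoming z a and outgoing z b' from a' and b; as α
≠ 0 they can be solved for (a', b') in terms of (a, b). -/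
theorem transfer_iff {z E α β a b a' b' : ℂ} (hz : ‖z‖ = 1) (hE : ‖E‖ = 1) (hα : α ≠ 0)
    (hn : ‖α‖ ^ 2 + ‖β‖ ^ 2 = 1) :
    (z * a = E * (α * a' + β * b) ∧ z * b' = E * (-conj β * a' + conj α * b)) ↔
    (α * a' = z * conj E * a - β * b ∧ α * b' = -conj β * a + conj (z * conj E) * b) := by
  have hzc : z * conj z = 1 := by rw [Complex.mul_conj']; simp [hz]
  have hEc : E * conj E = 1 := by rw [Complex.mul_conj']; simp [hE]
  have hz0 : z ≠ 0 := by rintro rfl; simp at hz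
  have hE0 : E ≠ 0 := by rintro rfl; simp at hE
  have hαβ : α * conj α + β * conj β = 1 := by
    rw [Complex.mul_conj', Complex.mul_conj']; exact_mod_cast hn
  simp only [map_mul, Complex.conj_conj]
  constructor
  · rintro ⟨h1, h2⟩
    have h3 : α * a' = z * conj E * a - β * b := by
      linear_combination -(conj E) * h1 - (α * a' + β * b) * hEc
    refine ⟨h3, mul_left_cancel₀ hz0 ?_⟩
    linear_combination α * h2 - E * conj β * h3 + E * b * hαβ - conj β * z * a * hEc
      - E * b * hzc
  · rintro ⟨h3, h4⟩
    refine ⟨?_, mul_left_cancel₀ hα ?_⟩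
    · linear_combination -E * h3 - z * a * hEc
    · linear_combination z * h4 + E * conj β * h3 - E * b * hαβ + conj β * z * a * hEc
        + E * b * hzc

/-- The inverse transfer has the same form with (α, β, ω) replaced by (conj α, -β, conj ω), so
results on the right half-line apply to the left one. -/
theorem transfer_symm {α β ω a b a' b' : ℂ} (hα : α ≠ 0) (hω : ‖ω‖ = 1)
    (hn : ‖α‖ ^ 2 + ‖β‖ ^ 2 = 1) :
    (α * a' = ω * a - β * b ∧ α * b' = -conj β * a + conj ω * b) ↔
    (conj α * a = conj ω * a' - (-β) * b' ∧
      conj α * b = -conj (-β) * a' + conj (conj ω) * b') := by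
  have hωc : ω * conj ω = 1 := by rw [Complex.mul_conj']; simp [hω]
  have hαβ : α * conj α + β * conj β = 1 := by
    rw [Complex.mul_conj', Complex.mul_conj']; exact_mod_cast hn
  have hα' : conj α ≠ 0 := (map_ne_zero _).2 hα
  simp only [map_neg, Complex.conj_conj]
  constructor
  · rintro ⟨h1, h2⟩
    constructor <;> refine mul_left_cancel₀ hα ?_
    · linear_combination -conj ω * h1 - β * h2 + a * hαβ - a * hωc
    · linear_combination -conj β * h1 - ω * h2 + b * hαβ - b * hωc
  · rintro ⟨h1, h2⟩
    constructor <;> refine mul_left_cancel₀ hα' ?_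
    · linear_combination -ω * h1 + β * h2 + a' * hαβ - a' * hωc
    · linear_combination conj β * h1 - conj ω * h2 + b' * hαβ - b' * hωc

/-! ### The quantization condition -/

section Quantization

variable {z E F : ℂ} {κ s : ℝ}

theorem normSq_phase_sum (hE : ‖E‖ = 1) (hF : ‖F‖ = 1) :
    ‖E + Complex.I * s * F‖ ^ 2 = 1 + s ^ 2 + 2 * s * (E * conj F).im := by
  rw [← Complex.normSq_eq_norm_sq]
  have h1 : E.re * E.re + E.im * E.im = 1 := by
    rw [← Complex.normSq_apply, Complex.normSq_eq_norm_sq, hE]; norm_num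
  have h2 : F.re * F.re + F.im * F.im = 1 := by
    rw [← Complex.normSq_apply, Complex.normSq_eq_norm_sq, hF]; norm_num
  simp [Complex.normSq_apply]
  linear_combination h1 + s ^ 2 * h2

theorem phase_sum_ne_zero (hE : ‖E‖ = 1) (hF : ‖F‖ = 1) (hs : s ^ 2 < 1) :
    E + Complex.I * s * F ≠ 0 := by
  intro h
  have h1 : E = -(Complex.I * s * F) := eq_neg_of_add_eq_zero_left h
  have h2 : ‖E‖ ^ 2 = s ^ 2 := by rw [h1]; simp [hF]
  rw [hE] at h2
  linarith

/-- Conjugating the condition and multiplying by z² gives a second equation with the same term κz;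
subtracting removes κ. -/
theorem eq_of_quantization (hz : ‖z‖ = 1) (hE : ‖E‖ = 1) (hF : ‖F‖ = 1) (hs : s ^ 2 < 1)
    (h : (z * conj E - κ) * z = Complex.I * s * F) :
    (z = (E + Complex.I * s * F) / ‖E + Complex.I * s * F‖ ∨
      z = -((E + Complex.I * s * F) / ‖E + Complex.I * s * F‖)) ∧
    κ ^ 2 * ‖E + Complex.I * s * F‖ ^ 2 = (1 - s ^ 2) ^ 2 := by
  have hw0 := phase_sum_ne_zero hE hF hs
  have hzc : z * conj z = 1 := by rw [Complex.mul_conj']; simp [hz]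
  have hEc : E * conj E = 1 := by rw [Complex.mul_conj']; simp [hE]
  have hFc : F * conj F = 1 := by rw [Complex.mul_conj']; simp [hF]
  have hI := Complex.I_sq
  have hc := congrArg conj h
  simp only [map_mul, map_sub, Complex.conj_conj, Complex.conj_ofReal, Complex.conj_I] at hc
  have hwc : conj (E + Complex.I * s * F) = conj E - Complex.I * s * conj F := by
    simp only [map_add, map_mul, Complex.conj_ofReal, Complex.conj_I]; ring
  have hww : (E + Complex.I * s * F) * conj (E + Complex.I * s * F) =
      (‖E + Complex.I * s * F‖ : ℂ) ^ 2 := Complex.mul_conj' _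
  rw [hwc] at hww
  generalize hwdef : E + Complex.I * s * F = w at *
  have hn0 : (‖w‖ : ℂ) ≠ 0 := by simpa using hw0
  -- This is z² conj w = w.
  have hsq : z ^ 2 * (conj E - Complex.I * s * conj F) = w := by
    rw [← hwdef]
    linear_combination h - z ^ 2 * hc + (E * (z * conj z + 1) - κ * z) * hzc
  -- Substituting z = η w/‖w‖ back into the condition determines κ, with the same sign η as z.
  have hκ (η : ℂ) (hη : η ^ 2 = 1) (hz' : z * ‖w‖ = η * w) : κ * ‖w‖ = η * (1 - (s : ℂ) ^ 2) := by
    have e1 : (κ : ℂ) * ‖w‖ ^ 2 * z = (1 - (s : ℂ) ^ 2) * w := by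
      have e2 : w * conj E - Complex.I * s * F * (conj E - Complex.I * s * conj F)
          = 1 - (s : ℂ) ^ 2 := by
        rw [← hwdef]
        linear_combination hEc + (s : ℂ) ^ 2 * Complex.I ^ 2 * hFc + (s : ℂ) ^ 2 * hI
      linear_combination -(‖w‖ : ℂ) ^ 2 * h - (z ^ 2 * conj E - Complex.I * s * F) * hww
        + w * conj E * hsq + w * e2
    have e3 : w * (κ * ‖w‖) = w * (η * (1 - (s : ℂ) ^ 2)) := by
      linear_combination η * e1 - κ * ‖w‖ * η * hz' - w * κ * ‖w‖ * hη
    exact mul_left_cancel₀ hw0 e3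
  have hfac : (z * ‖w‖ - w) * (z * ‖w‖ + w) = 0 := by
    linear_combination -z ^ 2 * hww + w * hsq
  have hfin (η : ℂ) (hη : η ^ 2 = 1) (hz' : z * ‖w‖ = η * w) :
      κ ^ 2 * ‖w‖ ^ 2 = (1 - s ^ 2) ^ 2 := by
    have e := hκ η hη hz'
    have : (κ : ℂ) ^ 2 * (‖w‖ : ℂ) ^ 2 = (1 - (s : ℂ) ^ 2) ^ 2 := by
      linear_combination (κ * ‖w‖ + η * (1 - (s : ℂ) ^ 2)) * e + (1 - (s : ℂ) ^ 2) ^ 2 * hη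
    exact_mod_cast this
  rcases mul_eq_zero.1 hfac with h1 | h1
  · refine ⟨Or.inl ?_, hfin 1 (by norm_num) (by linear_combination h1)⟩
    rw [eq_div_iff hn0]; linear_combination h1
  · refine ⟨Or.inr ?_, hfin (-1) (by norm_num) (by linear_combination h1)⟩
    rw [← neg_div, eq_div_iff hn0]; linear_combination h1

theorem quantization_of_eq (hE : ‖E‖ = 1) (hF : ‖F‖ = 1) (hs : s ^ 2 < 1) {η : ℝ}
    (hη : η ^ 2 = 1) (hz : z = η * ((E + Complex.I * s * F) / ‖E + Complex.I * s * F‖))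
    (hκ : κ = η * ((1 - s ^ 2) / ‖E + Complex.I * s * F‖)) :
    ‖z‖ = 1 ∧ (z * conj E - κ) * z = Complex.I * s * F := by
  have hw0 := phase_sum_ne_zero hE hF hs
  have hEc : E * conj E = 1 := by rw [Complex.mul_conj']; simp [hE]
  have hFc : F * conj F = 1 := by rw [Complex.mul_conj']; simp [hF]
  have hI := Complex.I_sq
  have hwc : conj (E + Complex.I * s * F) = conj E - Complex.I * s * conj F := by
    simp only [map_add, map_mul, Complex.conj_ofReal, Complex.conj_I]; ring
  have hww : (E + Complex.I * s * F) * conj (E + Complex.I * s * F) =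
      (‖E + Complex.I * s * F‖ : ℂ) ^ 2 := Complex.mul_conj' _
  rw [hwc] at hww
  generalize hwdef : E + Complex.I * s * F = w at *
  have hn0 : (‖w‖ : ℂ) ≠ 0 := by simpa using hw0
  have hη' : (η : ℂ) ^ 2 = 1 := by exact_mod_cast hη
  constructor
  · have : |η| = 1 := by rwa [← sq_eq_sq₀ (abs_nonneg _) zero_le_one, sq_abs, one_pow]
    rw [hz]
    simp [this, hw0]
  · subst hz hκ
    push_cast
    field_simp
    rw [hη', ← hww]
    have e2 : w * conj E - Complex.I * s * F * (conj E - Complex.I * s * conj F)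
        = 1 - (s : ℂ) ^ 2 := by
      rw [← hwdef]
      linear_combination hEc + (s : ℂ) ^ 2 * Complex.I ^ 2 * hFc + (s : ℂ) ^ 2 * hI
    linear_combination w * e2

end Quantization

/-! ### Eigenvectors are glued from the two contracting eigenspaces -/

theorem QWSpace.tendsto_component (Ψ : QWSpace) (j : Fin 2) {f : ℕ → ℤ}
    (hf : Function.Injective f) : Tendsto (fun n => Ψ (f n) j) atTop (𝓝 0) := by
  have h1 := (QWSpace.summable_component Ψ j).tendsto_cofinite_zero
  have h2 := (h1.comp hf.tendsto_cofinite).sqrt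
  rw [Nat.cofinite_eq_atTop] at h2
  refine tendsto_zero_iff_norm_tendsto_zero.2 ?_
  simpa [Function.comp_def] using h2

/-- The transfer recursion at the coin `c` for the amplitudes on the two sides of a site. -/
def CoinParam.Transfer (c : CoinParam) (z a b a' b' : ℂ) : Prop :=
  c.α * a' = z * conj (Complex.exp (Complex.I * (c.Δ : ℂ))) * a - c.β * b ∧
  c.α * b' = -conj c.β * a + conj (z * conj (Complex.exp (Complex.I * (c.Δ : ℂ)))) * b

theorem norm_exp_I_mul (t : ℝ) : ‖Complex.exp (Complex.I * (t : ℂ))‖ = 1 := by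
  rw [mul_comm]; exact Complex.norm_exp_ofReal_mul_I t

theorem timeEvolution_eq_smul_iff_transfer (c : ℤ → CoinParam) (Ψ : QWSpace) {z : ℂ}
    (hz : ‖z‖ = 1) : timeEvolution c Ψ = z • Ψ ↔
      ∀ x : ℤ, (c x).Transfer z (Ψ (x - 1) 0) (Ψ x 1) (Ψ x 0) (Ψ (x + 1) 1) := by
  rw [timeEvolution_eq_smul_iff]
  exact forall_congr' fun x =>
    transfer_iff hz (norm_exp_I_mul _) (c x).α_ne_zero (c x).normalized

theorem CoinParam.norm_phase {c : CoinParam} {z : ℂ} (hz : ‖z‖ = 1) :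
    ‖z * conj (Complex.exp (Complex.I * (c.Δ : ℂ)))‖ = 1 := by
  rw [norm_mul, hz, RCLike.norm_conj, norm_exp_I_mul, one_mul]

theorem CoinParam.Transfer.eq_zero_iff {c : CoinParam} {z a b a' b' : ℂ} (hz : ‖z‖ = 1)
    (h : c.Transfer z a b a' b') : (a = 0 ∧ b = 0) ↔ (a' = 0 ∧ b' = 0) := by
  have hα := c.α_ne_zero
  have h' := (transfer_symm hα (CoinParam.norm_phase hz) c.normalized).1 h
  obtain ⟨h1, h2⟩ := h
  obtain ⟨h3, h4⟩ := h'
  have hα' : conj c.α ≠ 0 := (map_ne_zero _).2 hα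
  constructor
  · rintro ⟨rfl, rfl⟩
    simpa [hα] using And.intro h1 h2
  · rintro ⟨rfl, rfl⟩
    simpa [hα] using And.intro h3 h4

/-- Each transfer step is invertible, so a pair vanishing at one site would vanish at every site. -/
theorem ne_zero_of_transfer {c : ℤ → CoinParam} {Ψ : QWSpace} {z : ℂ} (hz : ‖z‖ = 1)
    (h : ∀ x : ℤ, (c x).Transfer z (Ψ (x - 1) 0) (Ψ x 1) (Ψ x 0) (Ψ (x + 1) 1)) (hΨ : Ψ ≠ 0)
    (x : ℤ) : Ψ (x - 1) 0 ≠ 0 ∨ Ψ x 1 ≠ 0 := by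
  by_contra! h0
  have hstep (y : ℤ) : (Ψ (y - 1) 0 = 0 ∧ Ψ y 1 = 0) ↔
      (Ψ (y + 1 - 1) 0 = 0 ∧ Ψ (y + 1) 1 = 0) := by
    rw [add_sub_cancel_right]
    exact (h y).eq_zero_iff hz
  have hall (y : ℤ) : Ψ (y - 1) 0 = 0 ∧ Ψ y 1 = 0 := by
    induction y using Int.inductionOn' (b := x) with
    | zero => exact h0
    | succ k _ hk => exact (hstep k).1 hk
    | pred k _ hk => exact (hstep (k - 1)).2 (by rwa [sub_add_cancel])
  refine hΨ ?_
  ext y j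
  fin_cases j
  · have := (hall (y + 1)).1
    rwa [add_sub_cancel_right] at this
  · exact (hall y).2

/-- Distinct roots would have product q, which is impossible when both squares are below q. -/
theorem eq_of_contracting_quadratic {κ κ' c q : ℝ} (h : κ ^ 2 - 2 * c * κ + q = 0)
    (h' : κ' ^ 2 - 2 * c * κ' + q = 0) (hκ : κ ^ 2 < q) (hκ' : κ' ^ 2 < q) : κ = κ' := by
  by_contra hne
  have h1 : κ + κ' = 2 * c := by
    refine mul_left_cancel₀ (sub_ne_zero.2 hne) ?_
    linear_combination h - h'
  have h2 : κ * κ' = q := by linear_combination κ * h1 - h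
  nlinarith [sq_nonneg (κ - κ')]

/-! ### Necessity of the quantization condition -/

section TwoPhase

variable {m o p : CoinParam} {b Δ : ℝ} {F z : ℂ}

theorem twoPhaseOneDefect_of_neg {x : ℤ} (hx : x < 0) : twoPhaseOneDefect m o p x = m :=
  if_pos hx

theorem twoPhaseOneDefect_zero : twoPhaseOneDefect m o p 0 = o := by
  simp [twoPhaseOneDefect]

theorem twoPhaseOneDefect_of_pos {x : ℤ} (hx : 0 < x) : twoPhaseOneDefect m o p x = p := by
  simp [twoPhaseOneDefect, hx.not_gt, hx.ne']

theorem quantization_of_hasEigenvalue (hb : 0 < b) (hβo : o.β = 0) (hβp : ‖p.β‖ = b)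
    (hβm : ‖m.β‖ = b) (hΔp : p.Δ = Δ) (hΔm : m.Δ = Δ)
    (hphase : F ^ 2 * m.β = Complex.exp (Complex.I * (o.Δ : ℂ)) ^ 2 * p.β)
    (h : Module.End.HasEigenvalue (timeEvolution (twoPhaseOneDefect m o p)) z) :
    ‖z‖ = 1 ∧ ∃ κ s : ℝ, (s = b ∨ s = -b) ∧ κ ^ 2 < 1 - b ^ 2 ∧
      (z * conj (Complex.exp (Complex.I * (Δ : ℂ))) - κ) * z = Complex.I * s * F := by
  obtain ⟨Ψ, hΨ⟩ := h.exists_hasEigenvector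
  have hΨ0 := hΨ.2
  have hU := hΨ.apply_eq_smul
  have hz := norm_eq_one_of_timeEvolution_eq_smul hU hΨ0
  rw [timeEvolution_eq_smul_iff_transfer _ _ hz] at hU
  have hne := ne_zero_of_transfer hz hU hΨ0
  have hβp0 : p.β ≠ 0 := by rw [← norm_pos_iff, hβp]; exact hb
  have hβm0 : m.β ≠ 0 := by rw [← norm_pos_iff, hβm]; exact hb
  have hαp := p.normalized
  have hαm := m.normalized
  have hstepp (n : ℕ) := hU ((n : ℤ) + 1)
  -- The left half-line is traversed outwards: n counts the steps away from the defect.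
  have hstepm (n : ℕ) := hU (-(n : ℤ) - 1)
  have hstepo := hU 0
  simp only [twoPhaseOneDefect_zero, CoinParam.Transfer, hβo] at hstepo
  have hlp : ∀ n : ℕ, 0 < (n : ℤ) + 1 := fun n => by positivity
  have hlm : ∀ n : ℕ, -(n : ℤ) - 1 < 0 := fun n => by omega
  simp only [twoPhaseOneDefect_of_pos (hlp _), CoinParam.Transfer, hΔp] at hstepp
  simp only [twoPhaseOneDefect_of_neg (hlm _), CoinParam.Transfer, hΔm] at hstepm
  have hω : ‖z * conj (Complex.exp (Complex.I * (Δ : ℂ)))‖ = 1 := by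
    rw [norm_mul, hz, RCLike.norm_conj, norm_exp_I_mul, one_mul]
  have hEo : Complex.exp (Complex.I * (o.Δ : ℂ)) *
      conj (Complex.exp (Complex.I * (o.Δ : ℂ))) = 1 := by
    rw [Complex.mul_conj', norm_exp_I_mul]; simp
  generalize z * conj (Complex.exp (Complex.I * (Δ : ℂ))) = ω at *
  generalize Complex.exp (Complex.I * (o.Δ : ℂ)) = Eo at *
  have hωc : ω * conj ω = 1 := by rw [Complex.mul_conj']; simp [hω]
  have hzc : z * conj z = 1 := by rw [Complex.mul_conj']; simp [hz]
  obtain ⟨-, κ, hκ, hκq, hvp⟩ := exists_contracting_eigenvalue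
    (a := fun n : ℕ => Ψ (n : ℤ) 0) (b := fun n : ℕ => Ψ ((n : ℤ) + 1) 1)
    p.α_ne_zero hβp0 hαp hω
    (fun n => by simpa using (hstepp n).1) (fun n => by simpa using (hstepp n).2)
    (Ψ.tendsto_component 0 (fun i j h => by simpa using h))
    (Ψ.tendsto_component 1 (fun i j h => by simpa using h))
    (by simpa using hne 1)
  obtain ⟨hA, κ', hκ', hκq', hvm⟩ := exists_contracting_eigenvalue
    (a := fun n : ℕ => Ψ (-(n : ℤ) - 1) 0) (b := fun n : ℕ => Ψ (-(n : ℤ)) 1)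
    (α := conj m.α) (β := -m.β) (ω := conj ω) ((map_ne_zero _).2 m.α_ne_zero)
    (neg_ne_zero.2 hβm0) (by simpa using hαm) (by simpa using hω)
    (fun n => by
      have := ((transfer_symm m.α_ne_zero hω hαm).1 (hstepm n)).1
      rw [sub_add_cancel] at this
      push_cast
      rw [neg_add, ← sub_eq_add_neg]
      exact this)
    (fun n => by
      have := ((transfer_symm m.α_ne_zero hω hαm).1 (hstepm n)).2
      rw [sub_add_cancel] at this
      push_cast
      rw [neg_add, ← sub_eq_add_neg]
      exact this)
    (Ψ.tendsto_component 0 (fun i j h => by simpa using h))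
    (Ψ.tendsto_component 1 (fun i j h => by simpa using h))
    (by simpa using hne 0)
  have hαα : ‖m.α‖ ^ 2 = ‖p.α‖ ^ 2 := by rw [hβp] at hαp; rw [hβm] at hαm; linarith
  simp only [RCLike.norm_conj, Complex.conj_re, hαα] at hκ' hκq'
  obtain rfl := eq_of_contracting_quadratic hκq hκq' hκ hκ'
  refine ⟨hz, κ, ?_⟩
  have hαb : ‖p.α‖ ^ 2 = 1 - b ^ 2 := by rw [← hβp]; linarith
  rw [hαb] at hκ hκq
  simp only [Nat.cast_zero, zero_add, neg_zero, zero_sub] at hvp hvm hA hstepo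
  obtain ⟨ho1, ho2⟩ := hstepo
  simp only [map_mul, map_zero, Complex.conj_conj] at ho1 ho2
  -- Since |ω| = 1, this is the quadratic equation for κ rewritten.
  have hcc : (ω - κ) * (conj ω - κ) = (b : ℂ) ^ 2 := by
    have h1 : ω + conj ω = 2 * (ω.re : ℂ) := by rw [Complex.add_conj]; push_cast; ring
    have h2 : (κ : ℂ) ^ 2 - 2 * ω.re * κ + (1 - (b : ℂ) ^ 2) = 0 := by exact_mod_cast hκq
    linear_combination hωc + h2 - κ * h1
  -- Matching the contracting lines through the diagonal defect; the nonzero amplitude Ψ_L(-1)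
  -- cancels.
  have hkey : (ω - κ) * z ^ 2 = -F ^ 2 * (conj ω - κ) := by
    refine mul_left_cancel₀ (mul_ne_zero hβm0 hA) ?_
    linear_combination z * Eo * m.β * (o.α * hvp - (ω - κ) * ho1 + p.β * ho2)
      - (ω - κ) * z ^ 2 * m.β * Ψ (-1) 0 * hEo + p.β * Eo ^ 2 * m.β * Ψ 0 1 * hzc
      + p.β * Eo ^ 2 * hvm + (conj ω - κ) * Ψ (-1) 0 * hphase
  -- Multiplying the matching condition by ω - κ makes it ((ω - κ) z)² = (i b F)²; the sign of the
  -- square root is the sign of s.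
  have hfac : ((ω - κ) * z - Complex.I * b * F) * ((ω - κ) * z + Complex.I * b * F) = 0 := by
    linear_combination (ω - κ) * hkey - F ^ 2 * hcc - (b : ℂ) ^ 2 * F ^ 2 * Complex.I_sq
  rcases mul_eq_zero.1 hfac with h1 | h1
  · exact ⟨b, Or.inl rfl, hκ, by linear_combination h1⟩
  · exact ⟨-b, Or.inr rfl, hκ, by push_cast; linear_combination h1⟩

end TwoPhase

/-- The sequence that is geometric with ratio `ρ` from `1` on, and with ratio `r` from `0`
downwards. -/
noncomputable def gluedGeometric (ρ r u v : ℂ) (x : ℤ) : ℂ :=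
  if 1 ≤ x then ρ ^ (x - 1).toNat * u else r ^ (-x).toNat * v

section GluedGeometric

variable {ρ r u v : ℂ}

theorem gluedGeometric_natCast_add_one (n : ℕ) :
    gluedGeometric ρ r u v ((n : ℤ) + 1) = ρ ^ n * u := by
  simp [gluedGeometric]

theorem gluedGeometric_neg_natCast (n : ℕ) :
    gluedGeometric ρ r u v (-(n : ℤ)) = r ^ n * v := by
  rw [gluedGeometric, if_neg (by omega)]
  simp

theorem summable_norm_sq_geometric {ρ : ℂ} (hρ : ‖ρ‖ < 1) (u : ℂ) :
    Summable fun n : ℕ => ‖ρ ^ n * u‖ ^ 2 := by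
  have h : ‖ρ‖ ^ 2 < 1 := by
    rw [sq_lt_one_iff₀ (norm_nonneg _)]; exact hρ
  refine ((summable_geometric_of_lt_one (by positivity) h).mul_right (‖u‖ ^ 2)).congr fun n => ?_
  rw [norm_mul, norm_pow]; ring

theorem summable_norm_sq_gluedGeometric (hρ : ‖ρ‖ < 1) (hr : ‖r‖ < 1) :
    Summable fun x : ℤ => ‖gluedGeometric ρ r u v x‖ ^ 2 := by
  refine Summable.of_nat_of_neg ?_ ?_
  · refine (summable_nat_add_iff 1).1 ?_
    simpa only [Nat.cast_add, Nat.cast_one, gluedGeometric_natCast_add_one] using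
      summable_norm_sq_geometric hρ u
  · simpa only [gluedGeometric_neg_natCast] using summable_norm_sq_geometric hr v

end GluedGeometric

/-- The state with given square summable components. -/
def QWSpace.mk (f g : ℤ → ℂ) (hf : Summable fun x => ‖f x‖ ^ 2)
    (hg : Summable fun x => ‖g x‖ ^ 2) : QWSpace :=
  ⟨fun x => !₂[f x, g x], by
    refine (memℓp_gen_iff (by norm_num)).2 ((hf.add hg).congr fun x => ?_)
    rw [ENNReal.toReal_ofNat, Real.rpow_ofNat, EuclideanSpace.norm_sq_eq, Fin.sum_univ_two]
    rfl⟩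

/-! ### Construction of eigenvectors from the quantization condition -/

section TwoPhase

variable {m o p : CoinParam} {b Δ : ℝ} {F z : ℂ}

theorem hasEigenvalue_of_quantization (hb : 0 < b) (hβo : o.β = 0) (hβp : ‖p.β‖ = b)
    (hβm : ‖m.β‖ = b) (hΔp : p.Δ = Δ) (hΔm : m.Δ = Δ) (hF : ‖F‖ = 1)
    (hphase : F ^ 2 * m.β = Complex.exp (Complex.I * (o.Δ : ℂ)) ^ 2 * p.β)
    (hz : ‖z‖ = 1) {κ s : ℝ} (hs : s ^ 2 = b ^ 2) (hκ : κ ^ 2 < 1 - b ^ 2)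
    (h : (z * conj (Complex.exp (Complex.I * (Δ : ℂ))) - κ) * z = Complex.I * s * F) :
    Module.End.HasEigenvalue (timeEvolution (twoPhaseOneDefect m o p)) z := by
  have hβm0 : m.β ≠ 0 := by rw [← norm_pos_iff, hβm]; exact hb
  have hβp0 : p.β ≠ 0 := by rw [← norm_pos_iff, hβp]; exact hb
  have hαp := p.normalized
  have hαm := m.normalized
  have hα0 := o.α_ne_zero
  have hαp0 := p.α_ne_zero
  have hαm0 : conj m.α ≠ 0 := (map_ne_zero _).2 m.α_ne_zero
  have hω : ‖z * conj (Complex.exp (Complex.I * (Δ : ℂ)))‖ = 1 := by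
    rw [norm_mul, hz, RCLike.norm_conj, norm_exp_I_mul, one_mul]
  have hEo : Complex.exp (Complex.I * (o.Δ : ℂ)) *
      conj (Complex.exp (Complex.I * (o.Δ : ℂ))) = 1 := by
    rw [Complex.mul_conj', norm_exp_I_mul]; simp
  obtain ⟨ω, hωdef⟩ : ∃ ω, ω = z * conj (Complex.exp (Complex.I * (Δ : ℂ))) := ⟨_, rfl⟩
  obtain ⟨Eo, hEodef⟩ : ∃ Eo, Eo = Complex.exp (Complex.I * (o.Δ : ℂ)) := ⟨_, rfl⟩
  rw [← hωdef] at h hω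
  rw [← hEodef] at hEo hphase
  have hzc : z * conj z = 1 := by rw [Complex.mul_conj']; simp [hz]
  have hz0 : z ≠ 0 := by rintro rfl; simp at hz
  have hEo0 : Eo ≠ 0 := by rintro rfl; simp at hEo
  have hββ (c : CoinParam) (hc : ‖c.β‖ = b) : c.β * conj c.β = (b : ℂ) ^ 2 := by
    rw [Complex.mul_conj', hc]
  have hratio (c : CoinParam) (hc : ‖c.β‖ = b) : ‖(κ : ℂ)‖ < ‖c.α‖ := by
    have := c.normalized
    rw [hc] at this
    refine lt_of_pow_lt_pow_left₀ 2 (norm_nonneg _) ?_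
    rw [Complex.norm_real, Real.norm_eq_abs, sq_abs]
    linarith
  have hρ : ‖(κ : ℂ) / p.α‖ < 1 := by
    rw [norm_div, div_lt_one (norm_pos_iff.2 hαp0)]
    exact hratio p hβp
  have hr : ‖(κ : ℂ) / conj m.α‖ < 1 := by
    rw [norm_div, div_lt_one (norm_pos_iff.2 hαm0), RCLike.norm_conj]
    exact hratio m hβm
  -- Absolute values in the quantization condition give |ω - κ| = b, so κ solves the characteristic
  -- quadratic.
  have hcc : (ω - κ) * (conj ω - κ) = (b : ℂ) ^ 2 := by
    have h1 : ‖ω - κ‖ ^ 2 = b ^ 2 := by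
      have := congrArg norm h
      simp only [norm_mul, hz, hF, mul_one, Complex.norm_I, one_mul, Complex.norm_real,
        Real.norm_eq_abs] at this
      rw [this, sq_abs, hs]
    have h2 : conj ω - κ = conj (ω - κ) := by simp
    rw [h2, Complex.mul_conj', ← Complex.ofReal_pow, h1, Complex.ofReal_pow]
  have hb0 : (b : ℂ) ≠ 0 := by exact_mod_cast hb.ne'
  have hne : ω - κ ≠ 0 := by
    intro h0
    rw [h0, zero_mul] at hcc
    exact pow_ne_zero 2 hb0 hcc.symm
  have hs' : (s : ℂ) ^ 2 = (b : ℂ) ^ 2 := by exact_mod_cast hs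
  -- The vector (β_m, -(conj ω - κ)) spans the left contracting line; (a₁, b₁) is its image under
  -- the defect, and `hvp` places that image on the right contracting line.
  obtain ⟨a₁, ha₁⟩ : ∃ a₁, a₁ = z * conj Eo * m.β / o.α := ⟨_, rfl⟩
  obtain ⟨b₁, hb₁⟩ : ∃ b₁, b₁ = -(conj z * Eo * (conj ω - κ)) / o.α := ⟨_, rfl⟩
  have hvp : (ω - κ) * a₁ = p.β * b₁ := by
    refine mul_left_cancel₀ (mul_ne_zero (mul_ne_zero hne hα0) (mul_ne_zero hz0 hEo0)) ?_
    have ho1 : o.α * a₁ = z * conj Eo * m.β := by rw [ha₁, mul_div_cancel₀ _ hα0]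
    have ho2 : o.α * b₁ = -(conj z * Eo * (conj ω - κ)) := by rw [hb₁, mul_div_cancel₀ _ hα0]
    linear_combination (ω - κ) * z * Eo * ((ω - κ) * ho1 - p.β * ho2) + (ω - κ) ^ 2 * z ^ 2 * m.β * hEo
      + m.β * ((ω - κ) * z + Complex.I * s * F) * h
      + Complex.I ^ 2 * F ^ 2 * m.β * hs' + (b : ℂ) ^ 2 * F ^ 2 * m.β * Complex.I_sq
      - (b : ℂ) ^ 2 * hphase + p.β * Eo ^ 2 * hcc
      + p.β * Eo ^ 2 * (ω - κ) * (conj ω - κ) * hzc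
  -- The second row of the eigenvector equation follows from the first because ω - κ ≠ 0.
  have hvp' : conj p.β * a₁ = (conj ω - κ) * b₁ := by
    refine mul_left_cancel₀ (mul_ne_zero hβp0 hne) ?_
    linear_combination (b : ℂ) ^ 2 * hvp + (ω - κ) * a₁ * hββ p hβp - p.β * b₁ * hcc
  -- `A` is shifted by one: A(x) is the left component at x - 1, so (A(x), B(x)) is the pair
  -- entering site x.
  obtain ⟨A, hA⟩ : ∃ A, A = gluedGeometric ((κ : ℂ) / p.α) (κ / conj m.α) a₁ m.β := ⟨_, rfl⟩
  obtain ⟨B, hB⟩ : ∃ B, B = gluedGeometric ((κ : ℂ) / p.α) (κ / conj m.α) b₁ (-(conj ω - κ)) :=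
    ⟨_, rfl⟩
  have hsA : Summable fun x : ℤ => ‖A (x + 1)‖ ^ 2 :=
    (Equiv.addRight (1 : ℤ)).summable_iff (f := fun x : ℤ => ‖A x‖ ^ 2) |>.2
      (hA ▸ summable_norm_sq_gluedGeometric hρ hr)
  have hsB : Summable fun x : ℤ => ‖B x‖ ^ 2 := hB ▸ summable_norm_sq_gluedGeometric hρ hr
  let Ψ := QWSpace.mk (fun x => A (x + 1)) B hsA hsB
  have hΨ0 (x : ℤ) : Ψ x 0 = A (x + 1) := rfl
  have hΨ1 (x : ℤ) : Ψ x 1 = B x := rfl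
  have hA0 : A 0 = m.β := by
    rw [hA]; simpa using gluedGeometric_neg_natCast (u := a₁) (v := m.β) 0
  have hB0 : B 0 = -(conj ω - κ) := by
    rw [hB]; simpa using gluedGeometric_neg_natCast (u := b₁) (v := -(conj ω - κ)) 0
  have hΨ : Ψ ≠ 0 := by
    intro h0
    apply hβm0
    rw [← hA0, show (0 : ℤ) = -1 + 1 by norm_num, ← hΨ0, h0]
    rfl
  refine Module.End.hasEigenvalue_of_hasEigenvector (x := Ψ)
    (Module.End.hasEigenvector_iff.2 ⟨Module.End.mem_eigenspace_iff.2 ?_, hΨ⟩)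
  rw [timeEvolution_eq_smul_iff_transfer _ _ hz]
  intro x
  simp only [hΨ0, hΨ1, sub_add_cancel]
  rcases lt_trichotomy x 0 with hx | rfl | hx
  · obtain ⟨n, rfl⟩ : ∃ n : ℕ, x = -((n + 1 : ℕ) : ℤ) := ⟨(-x - 1).toNat, by omega⟩
    rw [twoPhaseOneDefect_of_neg hx, CoinParam.Transfer, hΔm, ← hωdef,
      transfer_symm m.α_ne_zero hω hαm]
    have e : -((n + 1 : ℕ) : ℤ) + 1 = -(n : ℤ) := by push_cast; ring
    rw [e, hA, hB]
    simp only [gluedGeometric_neg_natCast, map_neg, Complex.conj_conj, pow_succ]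
    have hk : conj m.α * (κ / conj m.α) = κ := mul_div_cancel₀ _ hαm0
    generalize (κ : ℂ) / conj m.α = r at *
    constructor
    · linear_combination r ^ n * m.β * hk
    · linear_combination -r ^ n * (conj ω - κ) * hk - r ^ n * hββ m hβm + r ^ n * hcc
  · have hA1 : A (0 + 1) = a₁ := by
      rw [hA]; simpa using gluedGeometric_natCast_add_one (u := a₁) (v := m.β) 0
    have hB1 : B (0 + 1) = b₁ := by
      rw [hB]; simpa using gluedGeometric_natCast_add_one (u := b₁) (v := -(conj ω - κ)) 0
    rw [twoPhaseOneDefect_zero, CoinParam.Transfer, hA1, hB1, hA0, hB0, ha₁, hb₁, hβo, ← hEodef]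
    simp only [map_mul, map_zero, Complex.conj_conj]
    constructor <;> field_simp <;> ring
  · obtain ⟨n, rfl⟩ : ∃ n : ℕ, x = (n : ℤ) + 1 := ⟨(x - 1).toNat, by omega⟩
    rw [twoPhaseOneDefect_of_pos hx, CoinParam.Transfer, hΔp, ← hωdef]
    have e : (n : ℤ) + 1 + 1 = ((n + 1 : ℕ) : ℤ) + 1 := by push_cast; ring
    rw [e, hA, hB]
    simp only [gluedGeometric_natCast_add_one, pow_succ]
    have hk : p.α * (κ / p.α) = κ := mul_div_cancel₀ _ hαp0
    generalize (κ : ℂ) / p.α = r at *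
    constructor
    · linear_combination r ^ n * a₁ * hk - r ^ n * hvp
    · linear_combination r ^ n * b₁ * hk + r ^ n * hvp'

end TwoPhase

/-! ### Explicit eigenvalues and their distinctness -/

section TwoPhase

variable {m o p : CoinParam} {b Δ C : ℝ} {z : ℂ}

theorem normSq_phase_sum_exp (Δ C s : ℝ) :
    ‖Complex.exp (Complex.I * (Δ : ℂ)) + Complex.I * s * Complex.exp (Complex.I * (C : ℂ))‖ ^ 2 =
      1 + s ^ 2 + 2 * s * Real.sin (Δ - C) := by
  rw [normSq_phase_sum (norm_exp_I_mul _) (norm_exp_I_mul _), ← Complex.exp_conj,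
    ← Complex.exp_add, map_mul, Complex.conj_I, Complex.conj_ofReal]
  rw [show Complex.I * (Δ : ℂ) + -Complex.I * C = ((Δ - C : ℝ) : ℂ) * Complex.I by
    push_cast; ring, Complex.exp_ofReal_mul_I_im]

/-- The candidateEigenvalue eigenvalue with sign `s = ± b`. -/
noncomputable def candidateEigenvalue (Δ C s : ℝ) : ℂ :=
  (Complex.exp (Complex.I * (Δ : ℂ)) + Complex.I * s * Complex.exp (Complex.I * (C : ℂ))) /
    ‖Complex.exp (Complex.I * (Δ : ℂ)) + Complex.I * s * Complex.exp (Complex.I * (C : ℂ))‖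

theorem norm_candidateEigenvalue {s : ℝ} (hs : s ^ 2 < 1) : ‖candidateEigenvalue Δ C s‖ = 1 := by
  have := phase_sum_ne_zero (norm_exp_I_mul Δ) (norm_exp_I_mul C) hs
  rw [candidateEigenvalue, norm_div, Complex.norm_real, norm_norm, div_self (norm_ne_zero_iff.2 this)]

theorem mem_pointSpectrum_iff (hb : 0 < b) (hβo : o.β = 0) (hβp : ‖p.β‖ = b)
    (hβm : ‖m.β‖ = b) (hΔp : p.Δ = Δ) (hΔm : m.Δ = Δ)
    (hphase : Complex.exp (Complex.I * (C : ℂ)) ^ 2 * m.β =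
      Complex.exp (Complex.I * (o.Δ : ℂ)) ^ 2 * p.β) :
    z ∈ pointSpectrum (timeEvolution (twoPhaseOneDefect m o p)) ↔
      ∃ s : ℝ, (s = b ∨ s = -b) ∧ -s ^ 2 < s * Real.sin (Δ - C) ∧
        (z = candidateEigenvalue Δ C s ∨ z = -candidateEigenvalue Δ C s) := by
  have hb1 : b ^ 2 < 1 := by
    have h1 := p.normalized
    have h2 := norm_pos_iff.2 p.α_ne_zero
    rw [hβp] at h1
    nlinarith
  have hsq {s : ℝ} (h : s = b ∨ s = -b) : s ^ 2 = b ^ 2 := sq_eq_sq_iff_eq_or_eq_neg.2 h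
  have hnorm := normSq_phase_sum_exp Δ C
  constructor
  · intro hz
    obtain ⟨hz1, κ, s, hs, hκ, hq⟩ :=
      quantization_of_hasEigenvalue hb hβo hβp hβm hΔp hΔm hphase hz
    rw [← hsq hs] at hb1 hκ
    obtain ⟨h1, h2⟩ := eq_of_quantization hz1 (norm_exp_I_mul _) (norm_exp_I_mul _) hb1 hq
    refine ⟨s, hs, ?_, h1⟩
    rw [hnorm] at h2
    have h3 : 0 < 1 + s ^ 2 + 2 * s * Real.sin (Δ - C) := by
      rw [← hnorm]
      have := phase_sum_ne_zero (norm_exp_I_mul Δ) (norm_exp_I_mul C) hb1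
      positivity
    -- The decay bound κ² < 1 - s² is multiplied by ‖w‖², where κ²‖w‖² = (1 - s²)²; one factor 1 -
    -- s² > 0 then cancels.
    have h4 : 1 - s ^ 2 < 1 + s ^ 2 + 2 * s * Real.sin (Δ - C) := by
      have h5 := mul_lt_mul_of_pos_right hκ h3
      rw [h2, pow_two] at h5
      exact lt_of_mul_lt_mul_left h5 (by linarith)
    linarith
  · rintro ⟨s, hs, hlt, hz⟩
    have hs2 := hsq hs
    have hs1 : s ^ 2 < 1 := hs2 ▸ hb1
    obtain ⟨η, hη, hz'⟩ : ∃ η : ℝ, η ^ 2 = 1 ∧ z = η * candidateEigenvalue Δ C s := by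
      rcases hz with rfl | rfl
      · exact ⟨1, by norm_num, by simp⟩
      · exact ⟨-1, by norm_num, by simp⟩
    obtain ⟨h1, h2⟩ := quantization_of_eq (norm_exp_I_mul Δ) (norm_exp_I_mul C) hs1 hη hz' rfl
    refine hasEigenvalue_of_quantization hb hβo hβp hβm hΔp hΔm (norm_exp_I_mul _) hphase h1 hs2
      ?_ h2
    rw [mul_pow, hη, one_mul, div_pow, hnorm, ← hs2, div_lt_iff₀ (by nlinarith), pow_two]
    exact mul_lt_mul_of_pos_left (by linarith) (by linarith)

/-- Otherwise, after division by e^{iC}, e^{i(Δ-C)} - ib would be a real multiple t of e^{i(Δ-C)} +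
ib. Real parts give t = 1, hence b = 0, or cos(Δ - C) = 0, hence |sin(Δ - C)| = 1 > b. Taking η = ±1
separates the two pairs of eigenvalues. -/
theorem candidateEigenvalue_neg_ne_real_mul (hb : 0 < b) (hb1 : b ^ 2 < 1)
    (h1 : Real.sin (Δ - C) < b)
    (h2 : -b < Real.sin (Δ - C)) {η : ℝ} : candidateEigenvalue Δ C (-b) ≠ η * candidateEigenvalue Δ C b := by
  intro h
  have hw := phase_sum_ne_zero (norm_exp_I_mul Δ) (norm_exp_I_mul C) (s := -b) (by rwa [neg_sq])
  obtain ⟨t, ht⟩ : ∃ t : ℝ, Complex.exp (Complex.I * (Δ : ℂ)) +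
      Complex.I * (-b : ℝ) * Complex.exp (Complex.I * (C : ℂ)) =
      t * (Complex.exp (Complex.I * (Δ : ℂ)) + Complex.I * b * Complex.exp (Complex.I * (C : ℂ))) :=
    ⟨‖Complex.exp (Complex.I * (Δ : ℂ)) +
      Complex.I * (-b : ℝ) * Complex.exp (Complex.I * (C : ℂ))‖ * η /
      ‖Complex.exp (Complex.I * (Δ : ℂ)) + Complex.I * b * Complex.exp (Complex.I * (C : ℂ))‖, by
    rw [candidateEigenvalue, candidateEigenvalue, div_eq_iff (by simpa using hw)] at h
    push_cast at h ⊢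
    linear_combination h⟩
  have hmul : Complex.exp (Complex.I * (Δ : ℂ)) =
      Complex.exp (Complex.I * ((Δ - C : ℝ) : ℂ)) * Complex.exp (Complex.I * (C : ℂ)) := by
    rw [← Complex.exp_add]; push_cast; ring_nf
  rw [hmul] at ht
  have h3 : Complex.exp (Complex.I * ((Δ - C : ℝ) : ℂ)) + Complex.I * (-b : ℝ) =
      t * (Complex.exp (Complex.I * ((Δ - C : ℝ) : ℂ)) + Complex.I * b) :=
    mul_right_cancel₀ (Complex.exp_ne_zero (Complex.I * (C : ℂ))) (by linear_combination ht)
  rw [mul_comm Complex.I ((Δ - C : ℝ) : ℂ), Complex.exp_mul_I, ← Complex.ofReal_cos,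
    ← Complex.ofReal_sin] at h3
  have hre := congrArg Complex.re h3
  have him := congrArg Complex.im h3
  simp only [Complex.add_re, Complex.add_im, Complex.mul_re, Complex.mul_im, Complex.ofReal_re,
    Complex.ofReal_im, Complex.I_re, Complex.I_im] at hre him
  have h4 : (1 - t) * Real.cos (Δ - C) = 0 := by linarith
  rcases mul_eq_zero.1 h4 with h5 | h5
  · have : t = 1 := by linarith
    subst this
    linarith
  · have h6 := Real.sin_sq_add_cos_sq (Δ - C)
    rw [h5] at h6
    nlinarith

end TwoPhase

/-! ### The main theorem -/

theorem mainTheorem6 (m o p : CoinParam) (b Δ θp θm C : ℝ)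
    (hb : 0 < b) (hβo : o.β = 0) (hβp : ‖p.β‖ = b) (hβm : ‖m.β‖ = b)
    (hΔp : p.Δ = Δ) (hΔm : m.Δ = Δ)
    (hθp : p.β = (‖p.β‖ : ℂ) * Complex.exp (Complex.I * (θp : ℂ)))
    (hθm : m.β = (‖m.β‖ : ℂ) * Complex.exp (Complex.I * (θm : ℂ)))
    (hC : C = o.Δ + (θp - θm) / 2)
    (σ : Set ℂ) (hσ : σ = pointSpectrum (timeEvolution (twoPhaseOneDefect m o p)))
    (μ₁ μ₂ μ₃ μ₄ : ℂ)
    (hμ₁ : μ₁ = (Complex.exp (Complex.I * (Δ : ℂ)) -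
        Complex.I * (b : ℂ) * Complex.exp (Complex.I * (C : ℂ))) /
      (‖Complex.exp (Complex.I * (Δ : ℂ)) -
        Complex.I * (b : ℂ) * Complex.exp (Complex.I * (C : ℂ))‖ : ℂ))
    (hμ₂ : μ₂ = -μ₁)
    (hμ₃ : μ₃ = (Complex.exp (Complex.I * (Δ : ℂ)) +
        Complex.I * (b : ℂ) * Complex.exp (Complex.I * (C : ℂ))) /
      (‖Complex.exp (Complex.I * (Δ : ℂ)) +
        Complex.I * (b : ℂ) * Complex.exp (Complex.I * (C : ℂ))‖ : ℂ))
    (hμ₄ : μ₄ = -μ₃) :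
    σ.Nonempty ∧
    (Real.sin (Δ - C) ∈ Set.Ico (-1) b → μ₁ ∈ σ ∧ μ₂ ∈ σ) ∧
    (Real.sin (Δ - C) ∈ Set.Ioc (-b) 1 → μ₃ ∈ σ ∧ μ₄ ∈ σ) ∧
    (∀ z ∈ σ,
      (Real.sin (Δ - C) ∈ Set.Ico (-1) b ∧ (z = μ₁ ∨ z = μ₂)) ∨
      (Real.sin (Δ - C) ∈ Set.Ioc (-b) 1 ∧ (z = μ₃ ∨ z = μ₄))) ∧
    (Real.sin (Δ - C) ∈ Set.Ico (-1) b → Real.sin (Δ - C) ∈ Set.Ioc (-b) 1 →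
      σ = {μ₁, μ₂, μ₃, μ₄} ∧ σ.ncard = 4) := by
  -- Only the square of e^{iC} enters, which undoes the halving of the argument difference in C.
  have hphase : Complex.exp (Complex.I * (C : ℂ)) ^ 2 * m.β =
      Complex.exp (Complex.I * (o.Δ : ℂ)) ^ 2 * p.β := by
    rw [hθp, hθm, hβp, hβm, mul_left_comm, mul_left_comm _ (b : ℂ), ← Complex.exp_nat_mul,
      ← Complex.exp_nat_mul, ← Complex.exp_add, ← Complex.exp_add, hC]
    congr 2
    push_cast
    ring
  have hb1 : b ^ 2 < 1 := by
    have h1 := p.normalized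
    have h2 := norm_pos_iff.2 p.α_ne_zero
    rw [hβp] at h1
    nlinarith
  have e₁ : μ₁ = candidateEigenvalue Δ C (-b) := by
    rw [hμ₁, candidateEigenvalue]
    push_cast
    simp only [mul_neg, neg_mul, ← sub_eq_add_neg]
  have e₃ : μ₃ = candidateEigenvalue Δ C b := hμ₃
  have hmem (z : ℂ) : z ∈ σ ↔ (Real.sin (Δ - C) ∈ Set.Ico (-1) b ∧ (z = μ₁ ∨ z = μ₂)) ∨
      (Real.sin (Δ - C) ∈ Set.Ioc (-b) 1 ∧ (z = μ₃ ∨ z = μ₄)) := by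
    rw [hσ, mem_pointSpectrum_iff hb hβo hβp hβm hΔp hΔm hphase, hμ₂, hμ₄, e₁, e₃]
    simp only [Set.mem_Ico, Set.mem_Ioc, Real.neg_one_le_sin, Real.sin_le_one, true_and, and_true]
    constructor
    · rintro ⟨s, rfl | rfl, h, hz⟩
      · exact Or.inr ⟨by nlinarith, hz⟩
      · exact Or.inl ⟨by nlinarith, hz⟩
    · rintro (⟨h, hz⟩ | ⟨h, hz⟩)
      · exact ⟨-b, Or.inr rfl, by nlinarith, hz⟩
      · exact ⟨b, Or.inl rfl, by nlinarith, hz⟩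
  have h₁ (h : Real.sin (Δ - C) ∈ Set.Ico (-1) b) : μ₁ ∈ σ ∧ μ₂ ∈ σ :=
    ⟨(hmem _).2 (Or.inl ⟨h, Or.inl rfl⟩), (hmem _).2 (Or.inl ⟨h, Or.inr rfl⟩)⟩
  have h₃ (h : Real.sin (Δ - C) ∈ Set.Ioc (-b) 1) : μ₃ ∈ σ ∧ μ₄ ∈ σ :=
    ⟨(hmem _).2 (Or.inr ⟨h, Or.inl rfl⟩), (hmem _).2 (Or.inr ⟨h, Or.inr rfl⟩)⟩
  refine ⟨?_, h₁, h₃, fun z hz => (hmem z).1 hz, fun hc₁ hc₂ => ?_⟩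
  -- As b > 0, sin(Δ - C) ≥ b implies sin(Δ - C) > -b, so at least one condition always holds.
  · rcases lt_or_ge (Real.sin (Δ - C)) b with h | h
    · exact ⟨μ₁, (h₁ ⟨Real.neg_one_le_sin _, h⟩).1⟩
    · exact ⟨μ₃, (h₃ ⟨by linarith, Real.sin_le_one _⟩).1⟩
  · have hset : σ = {μ₁, μ₂, μ₃, μ₄} := by
      ext z
      rw [hmem]
      simp only [hc₁, hc₂, true_and, Set.mem_insert_iff, Set.mem_singleton_iff, or_assoc]
    refine ⟨hset, ?_⟩
    have hne {η : ℝ} : μ₁ ≠ η * μ₃ := by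
      rw [e₁, e₃]; exact candidateEigenvalue_neg_ne_real_mul hb hb1 hc₁.2 hc₂.1
    have h13 : μ₁ ≠ μ₃ := by simpa using hne (η := 1)
    have h14 : μ₁ ≠ -μ₃ := by simpa using hne (η := -1)
    have hn₁ : μ₁ ≠ 0 := by
      rw [← norm_ne_zero_iff, e₁, norm_candidateEigenvalue (by rwa [neg_sq])]; exact one_ne_zero
    have hn₃ : μ₃ ≠ 0 := by
      rw [← norm_ne_zero_iff, e₃, norm_candidateEigenvalue hb1]; exact one_ne_zero
    rw [hset, hμ₂, hμ₄, Set.ncard_insert_of_notMem, Set.ncard_insert_of_notMem,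
      Set.ncard_pair (self_ne_neg.2 hn₃)]
    · simp only [Set.mem_insert_iff, Set.mem_singleton_iff, neg_inj, not_or]
      exact ⟨fun h => h14 (by rw [← h, neg_neg]), h13⟩
    · simp only [Set.mem_insert_iff, Set.mem_singleton_iff, not_or]
      exact ⟨self_ne_neg.2 hn₁, h13, h14⟩
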